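/- Let $N,M\ge 0$ be integers and put $L=N+M$. Let $K$ be a field, let $\overline\alpha=(\alpha_0,\dots,\alpha_L)$ and $\overline\gamma=(\gamma_0,\dots,\gamma_L)$ be elements of $K$, and write $-\overline\alpha=(-\alpha_0,\dots,-\alpha_L)$, $-\overline\gamma=(-\gamma_0,\dots,-\gamma_L)$. For $\mu\ge 0$ and $z\in K^\times$ put $$g_\mu(z|\overline\alpha|\overline\gamma)=\prod_{j=0}^{\mu}\{\alpha_j+(1-\alpha_j\gamma_j)z\}\prod_{j=\mu+2}^{L}(1-\gamma_jz)\prod_{j=1}^{L}(1-\gamma_jz^{-1})\qquad(\mu\le L),$$ and for $z_1,\dots,z_n\in K^\times$ and a partition $\lambda=(\lambda_1\ge\dots\ge\lambda_n\ge 0)$ with $\lambda_1+n-1\le L$ define the generalized symplectic Schur function $$sp_\lambda(\{z\}_n|\overline\alpha|\overline\gamma)=\frac{\det\bigl(g_{\lambda_j+n-j}(z_k|\overline\alpha|\overline\gamma)-g_{\lambda_j+n-j}(z_k^{-1}|\overline\alpha|\overline\gamma)\bigr)_{1\le j,k\le n}}{\det\bigl(z_k^{n-j+1}-z_k^{-(n-j+1)}\bigr)_{1\le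 j,k\le n}}.$$ For a partition $\lambda\subseteq M^N$, that is, $M\ge\lambda_1\ge\dots\ge\lambda_N\ge 0$, let $\hat\lambda=(\hat\lambda_1,\dots,\hat\lambda_M)$ be the partition $\hat\lambda_i=|\{j\in\{1,\dots,N\}:\lambda_j\le M-i\}|$. Theorem (dual Cauchy formula). For all nonzero $x_1,\dots,x_N,y_1,\dots,y_M\in K$ for which the two denominators $\det(x_k^{N-j+1}-x_k^{-(N-j+1)})_{1\le j,k\le N}$ and $\det(y_k^{M-j+1}-y_k^{-(M-j+1)})_{1\le j,k\le M}$ do not vanish (in particular, when $x_j,y_k,\alpha_j,\gamma_j$ are independent variables and $K$ is the field of rational functions in them), $$\sum_{\lambda\subseteq M^N}sp_\lambda(\{x\}_N|\overline\alpha|\overline\gamma)\,sp_{\hat\lambda}(\{y\}_M|-\overline\alpha|-\overline\gamma)=\prod_{k=1}^{M}y_k^{-N}\prod_{j=1}^{N}\prod_{k=1}^{M}(1+x_jy_k)(1+x_j^{-1}y_k)\prod_{0\le j<k\le N+M}\bigl(1+\alpha_j(\gamma_k-\gamma_j)\bigr)\prod_{1\le j<k\le N+M}(1-\gamma_j\gamma_k).$$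 -/

import Mathlib

namespace GenSymplectic

/-- `g_μ(z | α_0,…,α_L | γ_0,…,γ_L)
  = ∏_{j=0}^{μ} (α_j + (1 - α_j γ_j) z) ∏_{j=μ+2}^{L} (1 - γ_j z) ∏_{j=1}^{L} (1 - γ_j z⁻¹)`.
The parameters are indexed by `ℕ`; for `μ ≤ L` only the entries `0,…,L` occur. -/
def g {K : Type*} [Field K] (L : ℕ) (α γ : ℕ → K) (μ : ℕ) (z : K) : K :=
  (∏ j ∈ Finset.range (μ + 1), (α j + (1 - α j * γ j) * z)) *
    (∏ j ∈ Finset.Icc (μ + 2) L, (1 - γ j * z)) *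
    (∏ j ∈ Finset.Icc 1 L, (1 - γ j * z⁻¹))

/-- The determinant `G_μ = det_N (g_{μ_j}(z_k) - g_{μ_j}(z_k⁻¹))`, with `j` the row index and
`k` the column index. -/
def G {K : Type*} [Field K] (L : ℕ) {N : ℕ} (α γ : ℕ → K) (μ : Fin N → ℕ) (z : Fin N → K) : K :=
  Matrix.det (Matrix.of fun j k : Fin N => g L α γ (μ j) (z k) - g L α γ (μ j) (z k)⁻¹)

/-- The denominator `det_N (z_k^{N-j+1} - z_k^{-N+j-1})` with `1 ≤ j ≤ N`; here the row index
starts at `0`, so that `N - j + 1` becomes `N - j`. -/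
def denom {K : Type*} [Field K] {N : ℕ} (z : Fin N → K) : K :=
  Matrix.det (Matrix.of fun j k : Fin N =>
    z k ^ ((N : ℤ) - (j : ℤ)) - z k ^ (-(N : ℤ) + (j : ℤ)))

/-- The generalized symplectic Schur function
`sp_λ(z | α_0,…,α_L | γ_0,…,γ_L) = G_{λ+δ}(z) / det_N (z_k^{N-j+1} - z_k^{-N+j-1})`,
with `δ = (N-1, N-2, …, 0)`. -/
def sp {K : Type*} [Field K] (L : ℕ) {N : ℕ} (α γ : ℕ → K) (lam : Fin N → ℕ) (z : Fin N → K) : K :=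
  G L α γ (fun j : Fin N => lam j + (N - 1 - (j : ℕ))) z / denom z

/-- The partitions `λ ⊆ M^N`: tuples `M ≥ λ_1 ≥ … ≥ λ_N ≥ 0`. -/
def boxPartitions (N M : ℕ) : Finset (Fin N → ℕ) :=
  (Fintype.piFinset fun _ : Fin N => Finset.range (M + 1)).filter
    fun lam => ∀ i j : Fin N, i ≤ j → lam j ≤ lam i

/-- The dual partition: for `1 ≤ i ≤ M`, `λ̂_i = |{j | λ_j ≤ M - i}|`
(here the index `i` starts at `0`). -/
def hatPartition {N : ℕ} (M : ℕ) (lam : Fin N → ℕ) : Fin M → ℕ := fun i =>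
  (Finset.univ.filter fun j : Fin N => lam j ≤ M - ((i : ℕ) + 1)).card

theorem mem_boxPartitions {N M : ℕ} {lam : Fin N → ℕ} :
    lam ∈ boxPartitions N M ↔ (∀ i, lam i ≤ M) ∧ Antitone lam := by
  simp only [boxPartitions, Finset.mem_filter, Fintype.mem_piFinset, Finset.mem_range,
    Nat.lt_succ_iff]
  exact Iff.rfl

/-- `λ̂` is a partition contained in `N^M`. -/
theorem hatPartition_mem {N : ℕ} (M : ℕ) (lam : Fin N → ℕ) :
    hatPartition M lam ∈ boxPartitions M N := by
  refine mem_boxPartitions.2 ⟨fun i => ?_, fun i i' h => Finset.card_le_card fun j hj => ?_⟩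
  · exact (Finset.card_filter_le _ _).trans (by simp)
  · simp only [Finset.mem_filter, Finset.mem_univ, true_and] at hj ⊢
    have : (i : ℕ) ≤ i' := h
    omega

end GenSymplectic

/-! With L = N + M, the L functions g_a(z) - g_a(z⁻¹), a < L, lie in the span of the L functions
z^(b+1) - z^(-(b+1)). Hence their determinant at any L nonzero points is a constant, the determinant
of `coeffMatrix`, times a symplectic Vandermonde determinant (`det_g_sub_g_inv`). Take the points to
be the x's followed by the y's. Laplace expansion along these two column blocks gives a signed sum
of products G(x) G(y) over partitions in the box, the complementary rows being indexed by the dual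
partition (`sum_sign_mul_G_mul_G`). Negating the parameters amounts to y ↦ -y up to sign, which
absorbs the Laplace signs (`sum_G_mul_G_neg_neg`). The Vandermonde factor splits into the two
denominators and the Cauchy product (`denom_append`). The constant is found by evaluating at γ_1, …,
γ_L, where the matrix of functions becomes triangular (`det_coeffMatrix_of_generic`); passing to
indeterminate γ removes the genericity assumptions (`det_coeffMatrix`). -/

namespace GenSymplectic

open Matrix Finset

/-! ### The symplectic Vandermonde determinant. -/

section SymplecticVandermonde

variable {K : Type*} [Field K]

/-- The matrix with entries `z_b^{a+1} - z_b^{-(a+1)}`. -/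
def spMatrix {n : ℕ} (z : Fin n → K) : Matrix (Fin n) (Fin n) K :=
  of fun a b => z b ^ ((a : ℕ) + 1) - (z b)⁻¹ ^ ((a : ℕ) + 1)

theorem monic_natDegree_chebyshev_S (n : ℕ) :
    ((Polynomial.Chebyshev.S K n).Monic ∧ (Polynomial.Chebyshev.S K n).natDegree = n) ∧
      (Polynomial.Chebyshev.S K (n + 1 : ℕ)).Monic ∧
        (Polynomial.Chebyshev.S K (n + 1 : ℕ)).natDegree = n + 1 := by
  induction n with
  | zero => simp
  | succ n ih =>
    refine ⟨ih.2, ?_⟩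
    obtain ⟨⟨h1, h2⟩, h3, h4⟩ := ih
    have hS : Polynomial.Chebyshev.S K (n + 1 + 1 : ℕ) =
        Polynomial.X * Polynomial.Chebyshev.S K (n + 1 : ℕ) - Polynomial.Chebyshev.S K n := by
      have := Polynomial.Chebyshev.S_add_two K n
      push_cast
      rw [← this]
      congr 1
    have hm : (Polynomial.X * Polynomial.Chebyshev.S K (n + 1 : ℕ)).Monic :=
      Polynomial.monic_X.mul h3
    have hd : (Polynomial.X * Polynomial.Chebyshev.S K (n + 1 : ℕ)).natDegree = n + 1 + 1 := by
      rw [Polynomial.monic_X.natDegree_mul h3, h4, Polynomial.natDegree_X]; ring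
    have hlt : (Polynomial.Chebyshev.S K n).natDegree <
        (Polynomial.X * Polynomial.Chebyshev.S K (n + 1 : ℕ)).natDegree := by
      rw [hd, h2]; omega
    rw [hS]
    refine ⟨hm.sub_of_left ?_, ?_⟩
    · exact Polynomial.degree_lt_degree hlt
    · rw [Polynomial.natDegree_sub_eq_left_of_natDegree_lt hlt, hd]

theorem sub_inv_mul_eval_chebyshev_S {z : K} (hz : z ≠ 0) (n : ℕ) :
    (z - z⁻¹) * (Polynomial.Chebyshev.S K n).eval (z + z⁻¹) = z ^ (n + 1) - z⁻¹ ^ (n + 1) := by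
  induction n using Nat.twoStepInduction with
  | zero => simp
  | one => simp; ring
  | more n h0 h1 =>
    have hS := Polynomial.Chebyshev.S_add_two K n
    push_cast at h1 ⊢
    rw [hS, Polynomial.eval_sub, Polynomial.eval_mul, Polynomial.eval_X, mul_sub, h0,
      mul_left_comm, h1]
    have : z * z⁻¹ = 1 := mul_inv_cancel₀ hz
    linear_combination (z ^ (n + 1) - z⁻¹ ^ (n + 1)) * this

/-- Each entry is z - z⁻¹ times a monic polynomial of degree a in z + z⁻¹ (a rescaled Chebyshev
polynomial), so this is an ordinary Vandermonde determinant in z + z⁻¹ with scaled columns. -/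
theorem det_spMatrix {n : ℕ} (z : Fin n → K) (hz : ∀ i, z i ≠ 0) :
    (spMatrix z).det = (∏ i, (z i - (z i)⁻¹)) *
      ∏ i : Fin n, ∏ j ∈ Ioi i, ((z j + (z j)⁻¹) - (z i + (z i)⁻¹)) := by
  have h := det_eval_matrixOfPolynomials_eq_det_vandermonde (fun i => z i + (z i)⁻¹)
    (fun i : Fin n => Polynomial.Chebyshev.S K (i : ℕ))
    (fun i => (monic_natDegree_chebyshev_S (K := K) i).1.2)
    (fun i => (monic_natDegree_chebyshev_S (K := K) i).1.1)
  rw [← det_vandermonde, h, ← det_mul_column, ← det_transpose]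
  congr 1
  ext i j
  simp [spMatrix, sub_inv_mul_eval_chebyshev_S (hz i)]

theorem denom_eq_det_spMatrix {n : ℕ} (z : Fin n → K) :
    denom z = (spMatrix (z ∘ Fin.rev)).det := by
  rw [denom, ← det_submatrix_equiv_self Fin.revPerm]
  congr 1
  ext i j
  have h : (n : ℤ) - ((n - ((i : ℕ) + 1) : ℕ) : ℤ) = ((i : ℕ) + 1 : ℕ) := by omega
  have h' : -(n : ℤ) + ((n - ((i : ℕ) + 1) : ℕ) : ℤ) = -((i : ℕ) + 1 : ℕ) := by omega
  simp only [submatrix_apply, of_apply, Fin.revPerm_apply, Fin.val_rev, spMatrix, h, h',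
    Function.comp, _root_.zpow_neg, zpow_natCast, inv_pow]

theorem prod_Ioi_eq_prod_ite {R : Type*} [CommMonoid R] {n : ℕ} (f : Fin n → Fin n → R) :
    ∏ i : Fin n, ∏ j ∈ Ioi i, f i j = ∏ i : Fin n, ∏ j : Fin n, if i < j then f i j else 1 := by
  refine prod_congr rfl fun i _ => ?_
  rw [← prod_filter]
  congr 1
  ext j
  simp

theorem prod_Ioi_add {R : Type*} [CommMonoid R] {m n : ℕ} (f : Fin (m + n) → Fin (m + n) → R) :
    ∏ i : Fin (m + n), ∏ j ∈ Ioi i, f i j =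
      ((∏ i : Fin m, ∏ j ∈ Ioi i, f (Fin.castAdd n i) (Fin.castAdd n j)) *
        ∏ i : Fin m, ∏ j : Fin n, f (Fin.castAdd n i) (Fin.natAdd m j)) *
      ∏ i : Fin n, ∏ j ∈ Ioi i, f (Fin.natAdd m i) (Fin.natAdd m j) := by
  have h1 : ∏ i : Fin n, ∏ j : Fin m, (if Fin.natAdd m i < Fin.castAdd n j then
      f (Fin.natAdd m i) (Fin.castAdd n j) else 1) = 1 := by
    refine prod_eq_one fun i _ => prod_eq_one fun j _ => if_neg ?_
    simp only [Fin.lt_def, Fin.val_castAdd, Fin.val_natAdd]; omega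
  have h2 : ∏ i : Fin m, ∏ j : Fin n, (if Fin.castAdd n i < Fin.natAdd m j then
      f (Fin.castAdd n i) (Fin.natAdd m j) else 1) =
      ∏ i : Fin m, ∏ j : Fin n, f (Fin.castAdd n i) (Fin.natAdd m j) := by
    refine prod_congr rfl fun i _ => prod_congr rfl fun j _ => if_pos ?_
    simp only [Fin.lt_def, Fin.val_castAdd, Fin.val_natAdd]; omega
  simp only [prod_Ioi_eq_prod_ite, Fin.prod_univ_add, prod_mul_distrib, h1, h2, mul_one,
    mul_assoc]
  simp only [Fin.lt_def, Fin.val_castAdd, Fin.val_natAdd, add_lt_add_iff_left]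

theorem denom_eq_prod {n : ℕ} (z : Fin n → K) (hz : ∀ i, z i ≠ 0) :
    denom z = (∏ i, (z i - (z i)⁻¹)) *
      ∏ i : Fin n, ∏ j ∈ Ioi i, ((z i + (z i)⁻¹) - (z j + (z j)⁻¹)) := by
  rw [denom_eq_det_spMatrix z, det_spMatrix (z ∘ Fin.rev) fun i => hz _]
  congr 1
  · exact Fintype.prod_equiv Fin.revPerm _ _ fun i => rfl
  · simp only [prod_Ioi_eq_prod_ite]
    rw [prod_comm]
    refine Fintype.prod_equiv Fin.revPerm _ _ fun i => Fintype.prod_equiv Fin.revPerm _ _ fun j => ?_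
    simp

theorem denom_append {m n : ℕ} (x : Fin m → K) (y : Fin n → K) (hx : ∀ i, x i ≠ 0)
    (hy : ∀ i, y i ≠ 0) :
    denom (Fin.append x y) = denom x * denom y *
      ∏ i, ∏ j, ((x i + (x i)⁻¹) - (y j + (y j)⁻¹)) := by
  rw [denom_eq_prod x hx, denom_eq_prod y hy, denom_eq_prod _ fun i => ?_, Fin.prod_univ_add,
    prod_Ioi_add]
  · simp only [Fin.append_left, Fin.append_right]
    ring
  · refine Fin.addCases (fun i => ?_) (fun i => ?_) i <;> simp [hx, hy]

theorem denom_neg {n : ℕ} (z : Fin n → K) :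
    denom (-z) = (∏ j : Fin n, (-1) ^ (n - (j : ℕ))) * denom z := by
  rw [denom, denom, ← det_mul_column]
  congr 1
  ext i j
  have h : (n : ℤ) - (i : ℕ) = ((n - (i : ℕ) : ℕ) : ℤ) := by omega
  have h' : -(n : ℤ) + (i : ℕ) = -((n - (i : ℕ) : ℕ) : ℤ) := by omega
  simp only [of_apply, Pi.neg_apply, h, h', _root_.zpow_neg, zpow_natCast]
  rw [neg_pow, mul_inv, ← inv_pow (-1 : K), inv_neg_one]
  ring

end SymplecticVandermonde

/-! ### Expansion of g_a(z) - g_a(z⁻¹) in antisymmetric Laurent binomials. -/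

section Coefficients

open Polynomial

/-- The polynomial `z^L g_μ(z | α | γ)` in `z`. -/
noncomputable def gPoly {R : Type*} [CommRing R] (L : ℕ) (α γ : ℕ → R) (μ : ℕ) : R[X] :=
  (∏ j ∈ range (μ + 1), (C (α j) + C (1 - α j * γ j) * X)) *
    (∏ j ∈ Icc (μ + 2) L, (1 - C (γ j) * X)) * ∏ j ∈ Icc 1 L, (X - C (γ j))

/-- The coefficients of `g_a(z) - g_a(z⁻¹)` with respect to `z^{b+1} - z^{-(b+1)}`. -/
noncomputable def coeffMatrix {R : Type*} [CommRing R] (L : ℕ) (α γ : ℕ → R) :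
    Matrix (Fin L) (Fin L) R :=
  of fun a b => (gPoly L α γ a).coeff (L + 1 + b) - (gPoly L α γ a).coeff (L - 1 - b)

/-- There are (μ + 1) + (L - μ - 1) + L linear factors; for μ = L the count would be 2L + 1. -/
theorem natDegree_gPoly_le {R : Type*} [CommRing R] {L : ℕ} (α γ : ℕ → R) {μ : ℕ} (hμ : μ < L) :
    (gPoly L α γ μ).natDegree ≤ 2 * L := by
  have h1 : (∏ j ∈ range (μ + 1), (C (α j) + C (1 - α j * γ j) * X)).natDegree ≤ μ + 1 := by
    refine (natDegree_prod_le _ _).trans ((sum_le_card_nsmul _ _ 1 fun j _ => ?_).trans (by simp))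
    compute_degree
  have h2 : (∏ j ∈ Icc (μ + 2) L, (1 - C (γ j) * X)).natDegree ≤ L + 1 - (μ + 2) := by
    refine (natDegree_prod_le _ _).trans ((sum_le_card_nsmul _ _ 1 fun j _ => ?_).trans (by simp))
    compute_degree
  have h3 : (∏ j ∈ Icc 1 L, (X - C (γ j))).natDegree ≤ L := by
    refine (natDegree_prod_le _ _).trans ((sum_le_card_nsmul _ _ 1 fun j _ => ?_).trans (by simp))
    compute_degree
  exact natDegree_mul_le.trans ((Nat.add_le_add (natDegree_mul_le.trans (Nat.add_le_add h1 h2))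
    h3).trans (by omega))

theorem g_eq_eval_gPoly {K : Type*} [Field K] (L : ℕ) (α γ : ℕ → K) (μ : ℕ) {z : K}
    (hz : z ≠ 0) : g L α γ μ z = z⁻¹ ^ L * (gPoly L α γ μ).eval z := by
  have h : ∏ j ∈ Icc 1 L, (1 - γ j * z⁻¹) = z⁻¹ ^ L * ∏ j ∈ Icc 1 L, (z - γ j) := by
    have hc : z⁻¹ ^ L = ∏ _j ∈ Icc 1 L, z⁻¹ := by simp
    rw [hc, ← prod_mul_distrib]
    refine prod_congr rfl fun j _ => ?_
    field_simp
  simp only [g, h, gPoly, eval_mul, eval_prod, eval_add, eval_sub, eval_C, eval_X, eval_one]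
  ring

theorem eval_sub_eval_inv {K : Type*} [Field K] {L : ℕ} {p : K[X]} (hp : p.natDegree ≤ 2 * L)
    {z : K} (hz : z ≠ 0) :
    z⁻¹ ^ L * p.eval z - z ^ L * p.eval z⁻¹ =
      ∑ b : Fin L, (p.coeff (L + 1 + b) - p.coeff (L - 1 - b)) *
        (z ^ ((b : ℕ) + 1) - z⁻¹ ^ ((b : ℕ) + 1)) := by
  rw [Fin.sum_univ_eq_sum_range (fun b => (p.coeff (L + 1 + b) - p.coeff (L - 1 - b)) *
        (z ^ (b + 1) - z⁻¹ ^ (b + 1)))]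
  simp only [sub_mul (p.coeff _), sum_sub_distrib]
  -- The 2L + 1 coefficients split into L lower ones, the middle one, which antisymmetrization
  -- kills, and L upper ones; the lower block is reflected to pair with the upper.
  rw [eval_eq_sum_range' (n := L + 1 + L) (by omega), eval_eq_sum_range' (n := L + 1 + L) (by omega),
    mul_sum, mul_sum, ← sum_sub_distrib, sum_range_add, sum_range_succ, ← sum_range_reflect]
  have hzz : z * z⁻¹ = 1 := mul_inv_cancel₀ hz
  have h1 : ∀ n, z ^ n * z⁻¹ ^ n = 1 := fun n => by rw [← mul_pow, hzz, one_pow]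
  have e1 : ∑ j ∈ range L, (z⁻¹ ^ L * (p.coeff (L - 1 - j) * z ^ (L - 1 - j)) -
      z ^ L * (p.coeff (L - 1 - j) * z⁻¹ ^ (L - 1 - j))) =
      -∑ j ∈ range L, p.coeff (L - 1 - j) * (z ^ (j + 1) - z⁻¹ ^ (j + 1)) := by
    rw [← sum_neg_distrib]
    refine sum_congr rfl fun j hj => ?_
    have hj := mem_range.1 hj
    obtain ⟨k, rfl⟩ : ∃ k, L = k + (j + 1) := ⟨L - (j + 1), by omega⟩
    rw [show k + (j + 1) - 1 - j = k by omega, pow_add, pow_add]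
    linear_combination p.coeff k * (z⁻¹ ^ (j + 1) - z ^ (j + 1)) * h1 k
  have e2 : ∑ j ∈ range L, (z⁻¹ ^ L * (p.coeff (L + 1 + j) * z ^ (L + 1 + j)) -
      z ^ L * (p.coeff (L + 1 + j) * z⁻¹ ^ (L + 1 + j))) =
      ∑ j ∈ range L, p.coeff (L + 1 + j) * (z ^ (j + 1) - z⁻¹ ^ (j + 1)) := by
    refine sum_congr rfl fun j hj => ?_
    rw [add_assoc, add_comm 1 j, pow_add, pow_add]
    linear_combination p.coeff (L + (j + 1)) * (z ^ (j + 1) - z⁻¹ ^ (j + 1)) * h1 L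
  rw [e1, e2]
  ring

theorem g_sub_g_inv_eq_sum {K : Type*} [Field K] {L : ℕ} (α γ : ℕ → K) (a : Fin L) {z : K}
    (hz : z ≠ 0) :
    g L α γ a z - g L α γ a z⁻¹ =
      ∑ b, coeffMatrix L α γ a b * (z ^ ((b : ℕ) + 1) - z⁻¹ ^ ((b : ℕ) + 1)) := by
  rw [g_eq_eval_gPoly _ _ _ _ hz, g_eq_eval_gPoly _ _ _ _ (inv_ne_zero hz), inv_inv,
    eval_sub_eval_inv (natDegree_gPoly_le α γ a.2) hz]
  rfl

theorem det_g_sub_g_inv {K : Type*} [Field K] {L : ℕ} (α γ : ℕ → K) (w : Fin L → K)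
    (hw : ∀ i, w i ≠ 0) :
    det (of fun a b : Fin L => g L α γ a (w b) - g L α γ a (w b)⁻¹) =
      (coeffMatrix L α γ).det * (spMatrix w).det := by
  rw [← det_mul]
  congr 1
  ext a b
  rw [of_apply, g_sub_g_inv_eq_sum _ _ _ (hw b), mul_apply]
  rfl

theorem map_coeffMatrix {R S : Type*} [CommRing R] [CommRing S] (f : R →+* S) (L : ℕ)
    (α γ : ℕ → R) : f.mapMatrix (coeffMatrix L α γ) = coeffMatrix L (f ∘ α) (f ∘ γ) := by
  have h : ∀ μ, gPoly L (f ∘ α) (f ∘ γ) μ = (gPoly L α γ μ).map f := fun μ => by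
    simp [gPoly, Polynomial.map_prod]
  ext a b
  simp [coeffMatrix, h]

end Coefficients

/-! ### Evaluation of the coefficient determinant. -/

section CoefficientDeterminant

theorem prod_Icc_one_eq_prod_fin {R : Type*} [CommMonoid R] (L : ℕ) (f : ℕ → R) :
    ∏ j ∈ Icc 1 L, f j = ∏ j : Fin L, f (j + 1) := by
  rw [Fin.prod_univ_eq_prod_range (fun j => f (j + 1)), range_eq_Ico, prod_Ico_add']
  rfl

theorem prod_Icc_eq_prod_Ioi {R : Type*} [CommMonoid R] {L : ℕ} (a : Fin L) (f : ℕ → R) :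
    ∏ j ∈ Icc ((a : ℕ) + 2) L, f j = ∏ j ∈ Ioi a, f (j + 1) := by
  symm
  refine prod_bij (fun j _ => (j : ℕ) + 1) (fun j hj => ?_) (fun i _ j _ h => ?_) (fun j hj => ?_)
    fun j _ => rfl
  · have := mem_Ioi.1 hj
    simp only [Fin.lt_def] at this
    simp only [mem_Icc]; omega
  · exact Fin.ext (by omega)
  · simp only [mem_Icc] at hj
    refine ⟨⟨j - 1, by omega⟩, ?_, ?_⟩
    · simp only [mem_Ioi, Fin.lt_def]; omega
    · simp only; omega

theorem prod_Ico_one_eq_prod_Ioi {R : Type*} [CommMonoid R] (L : ℕ) (f : ℕ → ℕ → R) :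
    ∏ k ∈ Icc 1 L, ∏ j ∈ Ico 1 k, f j k =
      ∏ i : Fin L, ∏ j ∈ Ioi i, f (i + 1) (j + 1) := by
  have h : ∏ k ∈ Icc 1 L, ∏ j ∈ Ico 1 k, f j k = ∏ j ∈ Icc 1 L, ∏ k ∈ Icc (j + 1) L, f j k := by
    refine prod_comm' fun x y => ?_
    simp only [mem_Icc, mem_Ico]; omega
  rw [h, prod_Icc_one_eq_prod_fin]
  exact prod_congr rfl fun i _ => prod_Icc_eq_prod_Ioi i _

theorem prod_range_succ_prod_range {R : Type*} [CommMonoid R] (L : ℕ) (f : ℕ → ℕ → R) :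
    ∏ k ∈ range (L + 1), ∏ j ∈ range k, f j k =
      ∏ i : Fin L, ∏ j ∈ range (i + 1), f j (i + 1) := by
  rw [prod_range_succ', Fin.prod_univ_eq_prod_range (fun i => ∏ j ∈ range (i + 1), f j (i + 1))]
  simp

theorem prod_prod_eq_diag_mul_sq {R : Type*} [CommMonoid R] {n : ℕ} (f : Fin n → Fin n → R)
    (hf : ∀ i j, f i j = f j i) :
    ∏ i, ∏ j, f i j = (∏ i, f i i) * (∏ i, ∏ j ∈ Ioi i, f i j) ^ 2 := by
  have h1 : ∀ i : Fin n, ∏ j, f i j = f i i * ((∏ j ∈ Ioi i, f i j) * ∏ j ∈ Iio i, f i j) := by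
    intro i
    have hd : Disjoint (Ioi i) (Iio i) :=
      disjoint_left.2 fun j h h' => lt_asymm (mem_Ioi.1 h) (mem_Iio.1 h')
    have hu : (Ioi i) ∪ (Iio i) = {i}ᶜ := by
      ext j
      simp only [mem_union, mem_Ioi, mem_Iio, mem_compl, mem_singleton]
      rw [← ne_eq, ne_iff_lt_or_gt, or_comm]
    rw [← prod_union hd, hu]
    exact Fintype.prod_eq_mul_prod_compl i _
  have h2 : ∏ i, ∏ j ∈ Iio i, f i j = ∏ i, ∏ j ∈ Ioi i, f i j := by
    rw [prod_comm' (t' := univ) (s' := Ioi) (by simp)]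
    exact prod_congr rfl fun i _ => prod_congr rfl fun j _ => hf _ _
  simp only [h1, prod_mul_distrib, h2, sq]

variable {K : Type*} [Field K]

theorem g_param_eq_zero {L : ℕ} (α γ : ℕ → K) (a b : Fin L) (hb : γ (b + 1) ≠ 0) :
    g L α γ a (γ (b + 1)) = 0 := by
  rw [g, mul_eq_zero]
  right
  refine prod_eq_zero (i := (b : ℕ) + 1) (mem_Icc.2 ⟨by omega, by omega⟩) ?_
  rw [mul_inv_cancel₀ hb, sub_self]

theorem g_param_inv_eq_zero {L : ℕ} (α γ : ℕ → K) {a b : Fin L} (hab : a < b)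
    (hb : γ (b + 1) ≠ 0) : g L α γ a (γ (b + 1))⁻¹ = 0 := by
  rw [g, mul_eq_zero, mul_eq_zero]
  left; right
  refine prod_eq_zero (i := (b : ℕ) + 1) (mem_Icc.2 ⟨?_, by omega⟩) ?_
  · simp only [Fin.lt_def] at hab; omega
  · rw [mul_inv_cancel₀ hb, sub_self]

theorem g_param_inv_eq {L : ℕ} (α γ : ℕ → K) (a : Fin L) (ha : γ (a + 1) ≠ 0) :
    g L α γ a (γ (a + 1))⁻¹ = ((γ (a + 1))⁻¹ ^ ((a : ℕ) + 1) *
      ∏ j ∈ range (a + 1), (1 + α j * (γ (a + 1) - γ j))) *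
      (∏ j ∈ Ioi a, (1 - γ (j + 1) * (γ (a + 1))⁻¹)) *
      ∏ j : Fin L, (1 - γ (a + 1) * γ (j + 1)) := by
  rw [g, prod_Icc_eq_prod_Ioi, prod_Icc_one_eq_prod_fin, inv_inv]
  congr 1
  · congr 1
    have hc : (γ (a + 1))⁻¹ ^ ((a : ℕ) + 1) = ∏ _j ∈ range ((a : ℕ) + 1), (γ (a + 1))⁻¹ := by simp
    rw [hc, ← prod_mul_distrib]
    refine prod_congr rfl fun j _ => ?_
    field_simp
    ring
  · exact prod_congr rfl fun j _ => by rw [mul_comm]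

/-- The value of the determinant of the coefficient matrix of the functions
`g_a(z) - g_a(z⁻¹)`. -/
def coeffDet {R : Type*} [CommRing R] (L : ℕ) (α γ : ℕ → R) : R :=
  (∏ k ∈ range (L + 1), ∏ j ∈ range k, (1 + α j * (γ k - γ j))) *
    (∏ k ∈ Icc 1 L, ∏ j ∈ Ico 1 k, (1 - γ j * γ k))

/-- At z = γ_(b+1) the factors 1 - γ_j z⁻¹ kill g_a(z) for every a, and the factors 1 - γ_j z kill
g_a(z⁻¹) when a < b. The determinant is thus the product of its diagonal; genericity makes the
Vandermonde factor nonzero, so it can be cancelled. -/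
theorem det_coeffMatrix_of_generic (L : ℕ) (α γ : ℕ → K) (h0 : ∀ j, γ j ≠ 0)
    (hinj : Function.Injective γ) (h1 : ∀ j k, γ j * γ k ≠ 1) :
    (coeffMatrix L α γ).det = coeffDet L α γ := by
  set c : Fin L → K := fun a => γ (a + 1) with hc
  have hc0 : ∀ a, c a ≠ 0 := fun a => h0 _
  have hpair : ∀ a b, (c b + (c b)⁻¹) - (c a + (c a)⁻¹) =
      ((1 - c b * (c a)⁻¹) * (1 - c a * c b)) * (c b)⁻¹ := fun a b => by
    have := hc0 a; have := hc0 b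
    field_simp
    ring
  have hdiag : ∀ a, c a - (c a)⁻¹ = -((c a)⁻¹ * (1 - c a * c a)) := fun a => by
    have := hc0 a
    field_simp
    ring
  have hpow : ∏ a : Fin L, ∏ b ∈ Ioi a, (c b)⁻¹ = ∏ b, (c b)⁻¹ ^ (b : ℕ) := by
    rw [prod_comm' (t' := univ) (s' := Iio) (by simp)]
    simp
  have hsp := det_spMatrix c hc0
  have hne : (spMatrix c).det ≠ 0 := by
    rw [hsp]
    refine mul_ne_zero (prod_ne_zero_iff.2 fun a _ => ?_)
      (prod_ne_zero_iff.2 fun a _ => prod_ne_zero_iff.2 fun b hb => ?_)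
    · rw [hdiag, neg_ne_zero]
      exact mul_ne_zero (inv_ne_zero (hc0 a)) (sub_ne_zero.2 (h1 _ _).symm)
    · rw [hpair]
      refine mul_ne_zero (mul_ne_zero (sub_ne_zero.2 fun h => ?_) (sub_ne_zero.2 (h1 _ _).symm))
        (inv_ne_zero (hc0 b))
      have hab := mem_Ioi.1 hb
      have : c a = c b := by
        have := hc0 a
        field_simp at h
        exact h
      have := hinj this
      simp only [Fin.lt_def] at hab
      omega
  refine mul_right_cancel₀ hne ?_
  rw [← det_g_sub_g_inv α γ c hc0, det_of_isLowerTriangular, hsp]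
  · have hg : ∀ a : Fin L, g L α γ a (c a) - g L α γ a (c a)⁻¹ =
        (-((c a)⁻¹ * (c a)⁻¹ ^ (a : ℕ))) * (∏ j ∈ range (a + 1), (1 + α j * (γ (a + 1) - γ j))) *
          (∏ j ∈ Ioi a, (1 - c j * (c a)⁻¹)) * ∏ j : Fin L, (1 - c a * c j) := fun a => by
      rw [g_param_eq_zero α γ a a (hc0 a), g_param_inv_eq α γ a (hc0 a), pow_succ']
      ring
    simp only [of_apply, hg, hpair, hdiag, prod_mul_distrib, hpow, prod_neg, coeffDet,
      prod_range_succ_prod_range, prod_Ico_one_eq_prod_Ioi]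
    -- The diagonal and one copy of the off-diagonal product belong to the Vandermonde factor; the
    -- other copy survives in `coeffDet`.
    rw [prod_prod_eq_diag_mul_sq (fun a b => 1 - c a * c b) fun a b => by ring]
    ring
  · intro a b hab
    have hab : a < b := hab
    rw [of_apply, g_param_eq_zero α γ a b (hc0 b), g_param_inv_eq_zero α γ hab (hc0 b), sub_zero]

theorem map_coeffDet {R S : Type*} [CommRing R] [CommRing S] (f : R →+* S) (L : ℕ)
    (α γ : ℕ → R) : f (coeffDet L α γ) = coeffDet L (f ∘ α) (f ∘ γ) := by
  simp [coeffDet]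

/-- Both sides commute with ring homomorphisms, so it suffices to treat indeterminate γ, with α kept
constant, and then specialize. -/
theorem det_coeffMatrix (L : ℕ) (α γ : ℕ → K) :
    (coeffMatrix L α γ).det = coeffDet L α γ := by
  let R := MvPolynomial ℕ K
  let φ : R →+* FractionRing R := algebraMap R (FractionRing R)
  have hφ : Function.Injective φ := IsFractionRing.injective R (FractionRing R)
  let α' : ℕ → R := fun j => MvPolynomial.C (α j)
  let γ' : ℕ → R := MvPolynomial.X
  have key : (coeffMatrix L α' γ').det = coeffDet L α' γ' := by
    apply hφ
    rw [RingHom.map_det, map_coeffMatrix, map_coeffDet]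
    refine det_coeffMatrix_of_generic L _ _ (fun j h => ?_) (hφ.comp MvPolynomial.X_injective)
      fun j k h => ?_
    · exact MvPolynomial.X_ne_zero (R := K) j (hφ (h.trans (map_zero φ).symm))
    · have h' : γ' j * γ' k = 1 := hφ (by simpa using h)
      -- Evaluation at the origin turns X_j X_k = 1 into 0 = 1.
      simpa [γ'] using congrArg (MvPolynomial.eval (0 : ℕ → K)) h'
  have h := congrArg (MvPolynomial.eval γ) key
  rw [RingHom.map_det, map_coeffMatrix, map_coeffDet] at h
  have hα : MvPolynomial.eval γ ∘ α' = α := by ext j; simp [α']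
  have hγ : MvPolynomial.eval γ ∘ γ' = γ := by ext j; simp [γ']
  rwa [hα, hγ] at h

end CoefficientDeterminant

/-! ### Laplace expansion indexed by partitions in a box. -/

section Laplace

/-- Laplace expansion of a determinant along a block of columns; the permutations `π l` are
representatives of the left cosets of the Young subgroup. -/
theorem det_eq_sum_sign_mul_det_mul_det {R m n Λ : Type*} [CommRing R] [Fintype m] [Fintype n]
    [DecidableEq m] [DecidableEq n] [Fintype Λ] (π : Λ → Equiv.Perm (m ⊕ n))
    (hπ : Function.Bijective fun p : Λ × Equiv.Perm m × Equiv.Perm n =>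
      π p.1 * Equiv.Perm.sumCongrHom m n p.2) (B : Matrix (m ⊕ n) (m ⊕ n) R) :
    B.det = ∑ l, (Equiv.Perm.sign (π l) : ℤ) *
      ((B.submatrix (π l ∘ Sum.inl) Sum.inl).det * (B.submatrix (π l ∘ Sum.inr) Sum.inr).det) := by
  rw [det_apply', ← hπ.sum_comp, Fintype.sum_prod_type]
  refine sum_congr rfl fun l _ => ?_
  rw [Fintype.sum_prod_type, det_apply', det_apply', sum_mul_sum, mul_sum]
  refine sum_congr rfl fun τ _ => ?_
  rw [mul_sum]
  refine sum_congr rfl fun ρ _ => ?_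
  simp only [Equiv.Perm.sign_mul, Equiv.Perm.sumCongrHom_apply, Equiv.Perm.sign_sumCongr,
    Fintype.prod_sum_type, Equiv.Perm.mul_apply, Equiv.Perm.sumCongr_apply, Sum.map_inl,
    Sum.map_inr, submatrix_apply, Function.comp]
  push_cast
  ring

variable {N M : ℕ}

theorem hatPartition_le (lam : Fin N → ℕ) (i : Fin M) : hatPartition M lam i ≤ N :=
  (mem_boxPartitions.1 (hatPartition_mem M lam)).1 i

/-- The set counted by the dual partition is a final segment, so it contains everything from j on.
-/
theorem le_hatPartition {lam : Fin N → ℕ} (h : Antitone lam) {j : Fin N} {i : Fin M}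
    (hji : lam j ≤ M - (i + 1)) : N - j ≤ hatPartition M lam i := by
  rw [← Fin.card_Ici]
  refine card_le_card fun k hk => ?_
  simp only [mem_filter, mem_univ, true_and]
  exact (h (mem_Ici.1 hk)).trans hji

theorem hatPartition_le_of_lt {lam : Fin N → ℕ} (h : Antitone lam) {j : Fin N} {i : Fin M}
    (hji : M - (i + 1) < lam j) : hatPartition M lam i ≤ N - 1 - j := by
  rw [← Fin.card_Ioi]
  refine card_le_card fun k hk => ?_
  simp only [mem_filter, mem_univ, true_and] at hk
  rw [mem_Ioi]
  by_contra hle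
  have := h (not_lt.1 hle)
  omega

/-- The positions of the rows selected by a partition and by its dual. -/
def boxFun (lam : Fin N → ℕ) : Fin N ⊕ Fin M → ℕ :=
  Sum.elim (fun j => M - lam j + j) fun i => N - hatPartition M lam i + i

theorem boxFun_lt (lam : Fin N → ℕ) (s : Fin N ⊕ Fin M) : boxFun lam s < N + M := by
  rcases s with j | i <;> simp only [boxFun, Sum.elim_inl, Sum.elim_inr] <;> omega

theorem boxFun_inl_lt_inl {lam : Fin N → ℕ} (h : Antitone lam) {j k : Fin N} (hjk : j < k) :
    boxFun (M := M) lam (Sum.inl j) < boxFun (M := M) lam (Sum.inl k) := by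
  have := h hjk.le
  simp only [boxFun, Sum.elim_inl]
  have := Fin.lt_def.1 hjk
  omega

theorem boxFun_inr_lt_inr (lam : Fin N → ℕ) {j k : Fin M} (hjk : j < k) :
    boxFun lam (Sum.inr j) < boxFun lam (Sum.inr k) := by
  have := (mem_boxPartitions.1 (hatPartition_mem M lam)).2 hjk.le
  simp only [boxFun, Sum.elim_inr]
  have := Fin.lt_def.1 hjk
  omega

theorem boxFun_inl_lt_inr {lam : Fin N → ℕ} (h : Antitone lam) {j : Fin N} {i : Fin M}
    (hji : M - (i + 1) < lam j) : boxFun (M := M) lam (Sum.inl j) < boxFun lam (Sum.inr i) := by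
  have := hatPartition_le_of_lt h hji
  simp only [boxFun, Sum.elim_inl, Sum.elim_inr]
  omega

theorem boxFun_inr_lt_inl {lam : Fin N → ℕ} (h : Antitone lam) {j : Fin N} {i : Fin M}
    (hji : lam j ≤ M - (i + 1)) : boxFun (M := M) lam (Sum.inr i) < boxFun (M := M) lam (Sum.inl j) := by
  have := le_hatPartition h hji
  simp only [boxFun, Sum.elim_inl, Sum.elim_inr]
  omega

theorem boxFun_injective {lam : Fin N → ℕ} (h : Antitone lam) :
    Function.Injective (boxFun (M := M) lam) := by
  have hne : ∀ (j : Fin N) (i : Fin M), boxFun (M := M) lam (Sum.inl j) ≠ boxFun lam (Sum.inr i) :=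
    fun j i => (le_or_gt (lam j) (M - (i + 1))).elim (fun hc => (boxFun_inr_lt_inl h hc).ne')
      fun hc => (boxFun_inl_lt_inr h hc).ne
  rintro (j | i) (k | l) hs
  · exact congrArg _ (StrictMono.injective (f := fun j => boxFun (M := M) lam (Sum.inl j))
      (fun _ _ => boxFun_inl_lt_inl h) hs)
  · exact absurd hs (hne _ _)
  · exact absurd hs.symm (hne _ _)
  · exact congrArg _ (StrictMono.injective (f := fun j => boxFun (M := M) lam (Sum.inr j))
      (fun _ _ => boxFun_inr_lt_inr lam) hs)

theorem antitone_of_box (lam : boxPartitions N M) : Antitone lam.1 :=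
  (mem_boxPartitions.1 lam.2).2

/-- The bijection between rows and columns attached to a partition in the box. -/
noncomputable def boxEquiv (lam : boxPartitions N M) : Fin N ⊕ Fin M ≃ Fin (N + M) :=
  Equiv.ofBijective (fun s => ⟨boxFun lam.1 s, boxFun_lt lam.1 s⟩) <|
    (Fintype.bijective_iff_injective_and_card _).2
      ⟨fun _ _ h => boxFun_injective (antitone_of_box lam) (Fin.mk.inj_iff.1 h), by simp⟩

theorem val_boxEquiv (lam : boxPartitions N M) (s : Fin N ⊕ Fin M) :
    (boxEquiv lam s : ℕ) = boxFun lam.1 s := rfl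

/-- `boxEquiv` as a permutation. -/
noncomputable def boxPerm (lam : boxPartitions N M) : Equiv.Perm (Fin N ⊕ Fin M) :=
  (boxEquiv lam).trans finSumFinEquiv.symm

/-- Positions increase within each block, so the inversions are the mixed pairs (j, i) with λ_j ≤ M
- (i + 1); for fixed i the dual partition counts them. -/
theorem sign_boxPerm (lam : boxPartitions N M) :
    Equiv.Perm.sign (boxPerm lam) = ∏ i, (-1) ^ hatPartition M lam.1 i := by
  have h := antitone_of_box lam
  rw [← Equiv.Perm.sign_symm_trans_trans (boxPerm lam) finSumFinEquiv,
    Equiv.Perm.sign_eq_prod_prod_Ioi, prod_Ioi_add]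
  have h1 : ∀ s, ((finSumFinEquiv.symm.trans (boxPerm lam)).trans finSumFinEquiv) s =
      boxEquiv lam (finSumFinEquiv.symm s) := fun s => by simp [boxPerm]
  simp only [h1, finSumFinEquiv_symm_apply_castAdd, finSumFinEquiv_symm_apply_natAdd, Fin.lt_def,
    val_boxEquiv]
  have h2 : ∏ i : Fin N, ∏ j ∈ Ioi i, (if boxFun (M := M) lam.1 (Sum.inl i) <
      boxFun (M := M) lam.1 (Sum.inl j) then (1 : ℤˣ) else -1) = 1 :=
    prod_eq_one fun i _ => prod_eq_one fun j hj => if_pos (boxFun_inl_lt_inl h (mem_Ioi.1 hj))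
  have h3 : ∏ i : Fin M, ∏ j ∈ Ioi i, (if boxFun lam.1 (Sum.inr i) <
      boxFun lam.1 (Sum.inr j) then (1 : ℤˣ) else -1) = 1 :=
    prod_eq_one fun i _ => prod_eq_one fun j hj => if_pos (boxFun_inr_lt_inr _ (mem_Ioi.1 hj))
  rw [h2, h3, one_mul, mul_one, prod_comm]
  refine prod_congr rfl fun i _ => ?_
  rw [hatPartition, ← prod_const, prod_filter]
  refine prod_congr rfl fun j _ => ?_
  by_cases hc : lam.1 j ≤ M - (i + 1)
  · rw [if_pos hc, if_neg (boxFun_inr_lt_inl h hc).not_gt]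
  · rw [if_neg hc, if_pos (boxFun_inl_lt_inr h (not_le.1 hc))]

theorem add_le_of_strictMono {m n : ℕ} {f : Fin m → Fin n} (hf : StrictMono f) {i j : Fin m}
    (hij : i ≤ j) : (f i : ℕ) + (j - i) ≤ f j := by
  obtain ⟨d, hd⟩ : ∃ d, (j : ℕ) = i + d := ⟨j - i, by have := Fin.le_def.1 hij; omega⟩
  induction d generalizing j with
  | zero =>
    obtain rfl : i = j := Fin.ext (by omega)
    simp
  | succ d ih =>
    have h1 := ih (j := ⟨i + d, by omega⟩) (by simp [Fin.le_def]) rfl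
    have h2 : f ⟨i + d, by omega⟩ < f j := hf (Fin.lt_def.2 (by simp only; omega))
    have h2 := Fin.lt_def.1 h2
    simp only at h1
    omega

theorem exists_boxEquiv_inl_eq {f : Fin N → Fin (N + M)} (hf : StrictMono f) :
    ∃ lam : boxPartitions N M, ∀ j, boxEquiv lam (Sum.inl j) = f j := by
  have hle : ∀ j : Fin N, (j : ℕ) ≤ f j := fun j => by
    have := add_le_of_strictMono hf (i := ⟨0, j.pos⟩) (j := j) (by simp [Fin.le_def])
    simp only at this
    omega
  have hge : ∀ j : Fin N, (f j : ℕ) ≤ M + j := fun j => by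
    have := add_le_of_strictMono hf (i := j) (j := ⟨N - 1, by have := j.2; omega⟩) (by
      simp only [Fin.le_def]; omega)
    simp only at this
    omega
  -- Solves M - λ_j + j = f j; strict monotonicity gives j ≤ f j ≤ M + j, so no subtraction
  -- truncates.
  refine ⟨⟨fun j => M + j - f j, mem_boxPartitions.2 ⟨fun j => ?_, fun i j hij => ?_⟩⟩,
    fun j => Fin.ext ?_⟩
  · have := hle j
    omega
  · have := add_le_of_strictMono hf hij
    have := Fin.le_def.1 hij
    simp only
    omega
  · rw [val_boxEquiv]
    have := hle j
    have := hge j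
    simp only [boxFun, Sum.elim_inl]
    omega

theorem strictMono_boxEquiv_inl (lam : boxPartitions N M) :
    StrictMono (boxEquiv lam ∘ Sum.inl) := fun _ _ h => by
  rw [Fin.lt_def]
  exact boxFun_inl_lt_inl (antitone_of_box lam) h

theorem eq_of_boxEquiv_inl_eq {lam lam' : boxPartitions N M}
    (h : boxEquiv lam ∘ Sum.inl = boxEquiv lam' ∘ Sum.inl) : lam = lam' := by
  refine Subtype.ext (funext fun j => ?_)
  have h1 := congrArg Fin.val (congrFun h j)
  simp only [Function.comp, val_boxEquiv, boxFun, Sum.elim_inl] at h1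
  have := (mem_boxPartitions.1 lam.2).1 j
  have := (mem_boxPartitions.1 lam'.2).1 j
  omega

/-- A left coset of the Young subgroup is determined by the image of the first block, an N-subset of
the N + M positions, and such subsets correspond to partitions in the box. -/
theorem bijective_boxPerm_mul_sumCongr :
    Function.Bijective fun p : boxPartitions N M × Equiv.Perm (Fin N) × Equiv.Perm (Fin M) =>
      boxPerm p.1 * Equiv.Perm.sumCongrHom (Fin N) (Fin M) p.2 := by
  constructor
  · rintro ⟨lam, τ⟩ ⟨lam', τ'⟩ h
    simp only at h
    have hsub : ∀ (l l' : boxPartitions N M) (t t' : Equiv.Perm (Fin N) × Equiv.Perm (Fin M)),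
        boxPerm l * Equiv.Perm.sumCongrHom (Fin N) (Fin M) t =
          boxPerm l' * Equiv.Perm.sumCongrHom (Fin N) (Fin M) t' →
        Set.range (boxEquiv l ∘ Sum.inl) ⊆ Set.range (boxEquiv l' ∘ Sum.inl) := by
      rintro l l' t t' hl _ ⟨j, rfl⟩
      have h1 := congrArg finSumFinEquiv (DFunLike.congr_fun hl (Sum.inl (t.1⁻¹ j)))
      refine ⟨t'.1 (t.1⁻¹ j), ?_⟩
      simpa [boxPerm] using h1.symm
    have hl : lam = lam' := eq_of_boxEquiv_inl_eq <|
      ((strictMono_boxEquiv_inl lam).range_inj (strictMono_boxEquiv_inl lam')).1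
        ((hsub _ _ _ _ h).antisymm (hsub _ _ _ _ h.symm))
    subst hl
    rw [Equiv.Perm.sumCongrHom_injective (mul_left_cancel h)]
  · intro σ
    let f : Fin N → Fin (N + M) := fun j => finSumFinEquiv (σ (Sum.inl j))
    have hf : Function.Injective f :=
      finSumFinEquiv.injective.comp (σ.injective.comp Sum.inl_injective)
    -- Sorting the image of the first block yields the partition of the coset.
    obtain ⟨lam, hlam⟩ := exists_boxEquiv_inl_eq (f := f ∘ Tuple.sort f)
      ((Tuple.monotone_sort f).strictMono_of_injective (hf.comp (Tuple.sort f).injective))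
    have hmem : (boxPerm lam)⁻¹ * σ ∈ (Equiv.Perm.sumCongrHom (Fin N) (Fin M)).range := by
      refine Equiv.Perm.mem_sumCongrHom_range_of_perm_mapsTo_inl ?_
      rintro _ ⟨j, rfl⟩
      refine ⟨(Tuple.sort f)⁻¹ j, ?_⟩
      rw [Equiv.Perm.mul_apply, Equiv.Perm.eq_inv_iff_eq]
      apply finSumFinEquiv.injective
      simp [boxPerm, hlam, f]
    obtain ⟨p, hp⟩ := hmem
    exact ⟨(lam, p), by simp [hp]⟩

end Laplace

/-! ### Sign bookkeeping and the dual Cauchy identity. -/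

section DualCauchy

variable {K : Type*} [Field K]

/-- Only the μ + 1 factors containing α change sign; the others depend on γ and z only through γ_j z
and γ_j z⁻¹. -/
theorem g_neg_neg (L : ℕ) (α γ : ℕ → K) (μ : ℕ) (z : K) :
    g L (-α) (-γ) μ z = (-1) ^ (μ + 1) * g L α γ μ (-z) := by
  have hc : (-1 : K) ^ (μ + 1) = ∏ _j ∈ range (μ + 1), (-1 : K) := by simp
  simp only [g, Pi.neg_apply, inv_neg, mul_neg, neg_mul, neg_neg]
  rw [hc, ← mul_assoc, ← mul_assoc, ← prod_mul_distrib]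
  congr 2
  exact prod_congr rfl fun j _ => by ring

theorem G_neg_neg (L : ℕ) {n : ℕ} (α γ : ℕ → K) (μ : Fin n → ℕ) (z : Fin n → K) :
    G L (-α) (-γ) μ z = (∏ i, (-1) ^ (μ i + 1)) * G L α γ μ (-z) := by
  rw [G, G, ← det_mul_column]
  congr 1
  ext i j
  simp only [of_apply, g_neg_neg, Pi.neg_apply, inv_neg]
  ring

variable {N M : ℕ}

theorem rev_boxEquiv_inl (lam : boxPartitions N M) (j : Fin N) :
    ((boxEquiv lam (Sum.inl j)).rev : ℕ) = lam.1 j + (N - 1 - j) := by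
  rw [Fin.val_rev, val_boxEquiv]
  have := (mem_boxPartitions.1 lam.2).1 j
  simp only [boxFun, Sum.elim_inl]
  omega

theorem rev_boxEquiv_inr (lam : boxPartitions N M) (i : Fin M) :
    ((boxEquiv lam (Sum.inr i)).rev : ℕ) = hatPartition M lam.1 i + (M - 1 - i) := by
  rw [Fin.val_rev, val_boxEquiv]
  have := hatPartition_le lam.1 i
  simp only [boxFun, Sum.elim_inr]
  omega

theorem sum_sign_mul_G_mul_G (α γ : ℕ → K) (x : Fin N → K) (y : Fin M → K)
    (hx : ∀ i, x i ≠ 0) (hy : ∀ i, y i ≠ 0) :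
    ∑ lam : boxPartitions N M, (∏ i, (-1) ^ hatPartition M lam.1 i) *
      (G (N + M) α γ (fun j => lam.1 j + (N - 1 - j)) x *
        G (N + M) α γ (fun i => hatPartition M lam.1 i + (M - 1 - i)) y) =
      coeffDet (N + M) α γ * denom (Fin.append x y) := by
  set w := Fin.append x y with hw
  have hw0 : ∀ i, w i ≠ 0 := by
    refine Fin.addCases (fun i => ?_) fun i => ?_ <;> simp [hw, hx, hy]
  -- Rows are reversed so that position M - λ_j + j carries the index λ_j + N - 1 - j used in `sp`.
  let B : Matrix (Fin (N + M)) (Fin (N + M)) K := of fun a b =>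
    g (N + M) α γ a.rev (w b) - g (N + M) α γ a.rev (w b)⁻¹
  have hB : B.det = coeffDet (N + M) α γ * denom w := by
    rw [← det_coeffMatrix, denom_eq_det_spMatrix, ← det_g_sub_g_inv α γ (w ∘ Fin.rev) fun i => hw0 _,
      ← det_submatrix_equiv_self Fin.revPerm]
    congr 1
    ext a b
    simp [-Fin.val_rev, B]
  rw [← hB, ← det_submatrix_equiv_self finSumFinEquiv,
    det_eq_sum_sign_mul_det_mul_det boxPerm bijective_boxPerm_mul_sumCongr]
  refine sum_congr rfl fun lam _ => ?_
  rw [sign_boxPerm]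
  push_cast
  congr 2
  · rw [G]
    congr 1
    ext j k
    simp [-Fin.val_rev, B, boxPerm, rev_boxEquiv_inl, hw]
  · rw [G]
    congr 1
    ext j k
    simp [-Fin.val_rev, B, boxPerm, rev_boxEquiv_inr, hw]

theorem sum_G_mul_G_neg_neg (α γ : ℕ → K) (x : Fin N → K) (y : Fin M → K)
    (hx : ∀ i, x i ≠ 0) (hy : ∀ i, y i ≠ 0) :
    ∑ lam ∈ boxPartitions N M, G (N + M) α γ (fun j => lam j + (N - 1 - j)) x *
        G (N + M) (-α) (-γ) (fun i => hatPartition M lam i + (M - 1 - i)) y =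
      coeffDet (N + M) α γ * (denom x * denom y *
        ∏ i, ∏ j, ((x i + (x i)⁻¹) + (y j + (y j)⁻¹))) := by
  set s : K := ∏ i : Fin M, (-1) ^ (M - (i : ℕ)) with hs
  have hss : s * s = 1 := by
    rw [hs, ← prod_mul_distrib]
    exact prod_eq_one fun i _ => by rw [← mul_pow]; simp
  have hP : ∏ i, ∏ j, ((x i + (x i)⁻¹) - ((-y) j + ((-y) j)⁻¹)) =
      ∏ i, ∏ j, ((x i + (x i)⁻¹) + (y j + (y j)⁻¹)) := by
    refine prod_congr rfl fun i _ => prod_congr rfl fun j _ => ?_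
    rw [Pi.neg_apply, inv_neg]
    ring
  have h := sum_sign_mul_G_mul_G α γ x (-y) hx fun i => neg_ne_zero.2 (hy i)
  rw [denom_append x (-y) hx fun i => neg_ne_zero.2 (hy i), denom_neg, hP] at h
  calc _ = s * ∑ lam : boxPartitions N M, (∏ i, (-1) ^ hatPartition M lam.1 i) *
      (G (N + M) α γ (fun j => lam.1 j + (N - 1 - j)) x *
        G (N + M) α γ (fun i => hatPartition M lam.1 i + (M - 1 - i)) (-y)) := by
        rw [← sum_coe_sort, mul_sum]
        refine sum_congr rfl fun lam _ => ?_
        -- The dual-partition part of the sign is exactly the Laplace sign; the remaining `s`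
        -- cancels the sign of `denom (-y)`.
        have hsign : ∏ i : Fin M, (-1 : K) ^ (hatPartition M lam.1 i + (M - 1 - i) + 1) =
            s * ∏ i, (-1) ^ hatPartition M lam.1 i := by
          rw [hs, ← prod_mul_distrib]
          refine prod_congr rfl fun i _ => ?_
          rw [← pow_add]
          congr 1
          omega
        rw [G_neg_neg, hsign]
        ring
    _ = _ := by
        rw [h]
        linear_combination (coeffDet (N + M) α γ * (denom x * denom y *
          ∏ i, ∏ j, ((x i + (x i)⁻¹) + (y j + (y j)⁻¹)))) * hss

theorem prod_prod_add_inv_add_inv (x : Fin N → K) (y : Fin M → K) (hx : ∀ i, x i ≠ 0)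
    (hy : ∀ i, y i ≠ 0) :
    ∏ i, ∏ j, ((x i + (x i)⁻¹) + (y j + (y j)⁻¹)) =
      (∏ k, y k ^ (-(N : ℤ))) * ∏ j, ∏ k, (1 + x j * y k) * (1 + (x j)⁻¹ * y k) := by
  have h : ∏ k, y k ^ (-(N : ℤ)) = ∏ _j : Fin N, ∏ k, (y k)⁻¹ := by
    simp [prod_pow]
  rw [h, ← prod_mul_distrib]
  refine prod_congr rfl fun i _ => ?_
  rw [← prod_mul_distrib]
  refine prod_congr rfl fun j _ => ?_
  have := hx i
  have := hy j
  field_simp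
  ring

end DualCauchy

end GenSymplectic

theorem mainTheorem3 {K : Type*} [Field K] (N M : ℕ) (α γ : ℕ → K)
    (x : Fin N → K) (y : Fin M → K)
    (hx : ∀ j, x j ≠ 0) (hy : ∀ k, y k ≠ 0)
    (hdx : GenSymplectic.denom x ≠ 0) (hdy : GenSymplectic.denom y ≠ 0) :
    ∑ lam ∈ GenSymplectic.boxPartitions N M,
        GenSymplectic.sp (N + M) α γ lam x *
          GenSymplectic.sp (N + M) (-α) (-γ) (GenSymplectic.hatPartition M lam) y =
      (∏ k : Fin M, y k ^ (-(N : ℤ))) *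
        (∏ j : Fin N, ∏ k : Fin M, (1 + x j * y k) * (1 + (x j)⁻¹ * y k)) *
        (∏ k ∈ Finset.range (N + M + 1), ∏ j ∈ Finset.range k, (1 + α j * (γ k - γ j))) *
        (∏ k ∈ Finset.Icc 1 (N + M), ∏ j ∈ Finset.Ico 1 k, (1 - γ j * γ k)) := by
  have h := GenSymplectic.sum_G_mul_G_neg_neg α γ x y hx hy
  rw [GenSymplectic.prod_prod_add_inv_add_inv x y hx hy, GenSymplectic.coeffDet] at h
  simp only [GenSymplectic.sp, div_mul_div_comm]
  rw [← Finset.sum_div, h, div_eq_iff (mul_ne_zero hdx hdy)]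
  ring
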